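/- **Proposition.** Let $k\ge 2$ be an integer and, for $i\in\{0,\dots,k-1\}$, put $A_i=\begin{pmatrix} i+1&1\\1&0\end{pmatrix}$. For an integer $n\ge 0$ with base-$k$ expansion $(n)_k=i_s\cdots i_1i_0$ let $$\kappa(n)=\begin{pmatrix}1&0\end{pmatrix}A_{i_0}A_{i_1}\cdots A_{i_s}\begin{pmatrix}1\\0\end{pmatrix},$$ so that in particular $\kappa(0)=1$, and let $K(z)=\sum_{n\ge 0}\kappa(n)z^n$ for $|z|<1$. Let $G$ be any function that is meromorphic on $\mathbb{C}$ and transcendental over $\mathbb{C}(z)$. Then the functions $K(z)$ and $G(z)$ (regarded as meromorphic functions on the open unit disc) are algebraically independent over $\mathbb{C}(z)$. Moreover, $K(z)$ is transcendental over $\mathbb{C}(z)$. -/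

import Mathlib

open Filter Topology

/-! ### The sequence `κ` and its generating function -/

/-- The matrix `A_i = [[i + 1, 1], [1, 0]]` attached to the digit `i`. -/
def digitMatrix (i : ℕ) : Matrix (Fin 2) (Fin 2) ℤ :=
  !![(i : ℤ) + 1, 1; 1, 0]

/-- The `k`-regular sequence `κ(n) = [1 0] A_{i₀} A_{i₁} ⋯ A_{i_s} [1 0]ᵀ`, where `i_s ⋯ i₁ i₀` is the
base-`k` expansion of `n`. (`Nat.digits k n` is the list `[i₀, i₁, …, i_s]`, least significant
digit first; for `n = 0` it is empty, so `κ(0) = 1`, which is also the value for the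
one-digit expansion `0`.) -/
def kappa (k n : ℕ) : ℤ :=
  ![1, 0] ⬝ᵥ (((Nat.digits k n).map digitMatrix).prod.mulVec ![1, 0])

/-- The generating function `K(z) = ∑_{n ≥ 0} κ(n) zⁿ`, for `z` in the open unit disc. -/
noncomputable def genK (k : ℕ) (z : ℂ) : ℂ :=
  ∑' n : ℕ, (kappa k n : ℂ) * z ^ n

theorem abs_prod_digitMatrix_le (k : ℕ) (hk : 2 ≤ k) (l : List ℕ) (hl : ∀ i ∈ l, i < k) (j : Fin 2) :
    |((l.map digitMatrix).prod.mulVec ![1, 0]) j| ≤ ((k : ℤ) + 1) ^ l.length := by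
  induction l generalizing j with
  | nil => fin_cases j <;> simp
  | cons a l ih =>
    have ih' := ih (fun i hi => hl i (List.mem_cons_of_mem _ hi))
    have h0 := ih' 0
    have h1 := ih' 1
    have ha : (a : ℤ) + 1 ≤ k := by exact_mod_cast hl a List.mem_cons_self
    have ha0 : (0 : ℤ) ≤ a := Int.natCast_nonneg a
    rw [List.map_cons, List.prod_cons, ← Matrix.mulVec_mulVec, List.length_cons, pow_succ]
    set v := (l.map digitMatrix).prod.mulVec ![1, 0] with hv
    set B : ℤ := ((k : ℤ) + 1) ^ l.length with hB
    have hB0 : 0 ≤ B := (abs_nonneg _).trans h0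
    fin_cases j
    · have : (digitMatrix a).mulVec v 0 = ((a : ℤ) + 1) * v 0 + v 1 := by
        simp [digitMatrix, Matrix.mulVec, dotProduct, Fin.sum_univ_two]
      change |(digitMatrix a).mulVec v 0| ≤ _
      rw [this]
      calc |((a : ℤ) + 1) * v 0 + v 1| ≤ |((a : ℤ) + 1) * v 0| + |v 1| := abs_add_le _ _
        _ = ((a : ℤ) + 1) * |v 0| + |v 1| := by
            rw [abs_mul, abs_of_nonneg (by linarith : (0 : ℤ) ≤ (a : ℤ) + 1)]
        _ ≤ k * B + B := by
            gcongr
        _ = B * (k + 1) := by ring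
    · have : (digitMatrix a).mulVec v 1 = v 0 := by
        simp [digitMatrix, Matrix.mulVec, dotProduct, Fin.sum_univ_two]
      change |(digitMatrix a).mulVec v 1| ≤ _
      rw [this]
      nlinarith

theorem abs_kappa_le (k n : ℕ) (hk : 2 ≤ k) (hn : n ≠ 0) :
    |kappa k n| ≤ ((k : ℤ) * n) ^ 2 := by
  have h := abs_prod_digitMatrix_le k hk (Nat.digits k n)
    (fun i hi => Nat.digits_lt_base (by omega) hi) 0
  have hval : kappa k n = (((Nat.digits k n).map digitMatrix).prod.mulVec ![1, 0]) 0 := by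
    simp [kappa, dotProduct, Fin.sum_univ_two]
  rw [hval]
  have hk' : (2 : ℤ) ≤ k := by exact_mod_cast hk
  have hlen : (k : ℤ) ^ (Nat.digits k n).length ≤ k * n := by
    exact_mod_cast Nat.base_pow_length_digits_le k n (by omega) hn
  calc _ ≤ ((k : ℤ) + 1) ^ (Nat.digits k n).length := h
    _ ≤ ((k : ℤ) ^ 2) ^ (Nat.digits k n).length := by gcongr; nlinarith
    _ = ((k : ℤ) ^ (Nat.digits k n).length) ^ 2 := by rw [← pow_mul, ← pow_mul, mul_comm]
    _ ≤ _ := by gcongr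

/-- The series defining `K` converges on the open unit disc. -/
theorem summable_genK (k : ℕ) (hk : 2 ≤ k) (z : ℂ) (hz : ‖z‖ < 1) :
    Summable fun n : ℕ => (kappa k n : ℂ) * z ^ n := by
  have hs : Summable fun n : ℕ => (k : ℝ) ^ 2 * ((n : ℝ) ^ 2 * ‖z‖ ^ n) :=
    (summable_pow_mul_geometric_of_norm_lt_one 2 (r := ‖z‖) (by simpa using hz)).mul_left _
  refine Summable.of_norm_bounded_eventually_nat hs ?_
  filter_upwards [eventually_ne_atTop 0] with n hn
  have h : ‖(kappa k n : ℂ)‖ ≤ (k : ℝ) ^ 2 * (n : ℝ) ^ 2 := by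
    rw [Complex.norm_intCast, ← mul_pow]
    exact_mod_cast abs_kappa_le k n hk hn
  rw [norm_mul, norm_pow, ← mul_assoc]
  gcongr

/-! ### Functions on the unit disc as an algebra over `ℂ(z)` -/

/-- The ring of complex functions on the open unit disc, where two functions are identified when
they agree off a set that is closed and discrete in the disc. Meromorphic functions on the
disc (whose values at poles are immaterial) embed in this ring: their sums, products and equality
in it are the usual ones. -/
abbrev DiscFunction : Type :=
  Germ (codiscreteWithin (Metric.ball (0 : ℂ) 1)) ℂ

/-- The class of a function `f : ℂ → ℂ`, restricted to the open unit disc. -/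
noncomputable def DiscFunction.of (f : ℂ → ℂ) : DiscFunction := (f : DiscFunction)

theorem eventually_denom_ne_zero (r : RatFunc ℂ) :
    ∀ᶠ z in codiscreteWithin (Metric.ball (0 : ℂ) 1),
      Polynomial.eval₂ (RingHom.id ℂ) z r.denom ≠ 0 := by
  have hfin : {z : ℂ | r.denom.IsRoot z}.Finite :=
    Polynomial.finite_setOfPred_isRoot r.denom_ne_zero
  have := compl_finite_mem_codiscreteWithin (s := Metric.ball (0 : ℂ) 1) hfin
  filter_upwards [this] with z hz
  simpa [Polynomial.IsRoot, Polynomial.eval₂_id] using hz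

/-- A rational function `r ∈ ℂ(z)` viewed as the function `z ↦ r(z)` on the unit disc. -/
noncomputable def ratFuncToDisc : RatFunc ℂ →+* DiscFunction where
  toFun r := DiscFunction.of fun z => r.eval (RingHom.id ℂ) z
  map_one' := by
    refine Germ.coe_eq.2 (Eventually.of_forall fun z => ?_)
    simp
  map_zero' := by
    refine Germ.coe_eq.2 (Eventually.of_forall fun z => ?_)
    simp
  map_mul' r s := by
    refine Germ.coe_eq.2 ?_
    filter_upwards [eventually_denom_ne_zero r, eventually_denom_ne_zero s] with z hr hs
    exact RatFunc.eval_mul _ _ hr hs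
  map_add' r s := by
    refine Germ.coe_eq.2 ?_
    filter_upwards [eventually_denom_ne_zero r, eventually_denom_ne_zero s] with z hr hs
    exact RatFunc.eval_add _ _ hr hs

noncomputable instance instAlgebraRatFuncDiscFunction : Algebra (RatFunc ℂ) DiscFunction :=
  ratFuncToDisc.toAlgebra

/-! The function K is unbounded along the radii ending at infinitely many points of the unit circle,
and this excludes any algebraic relation with meromorphic coefficients. Such coefficients are
analytic on the circle, with nonvanishing leading one, off a finite set. Near any other point of the
circle a root of the polynomial is bounded (`not_isRoot_of_coeff_meromorphic`). So K is
transcendental over ℂ(z) and over ℂ(z)[G]; as G is transcendental over ℂ(z), K and G are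
algebraically independent.

The bad radii come from the functional equation `genK_functional_equation`, which involves a
companion series L. The point 1 is bad since κ ≥ 1, and a primitive k-th root of unity ζ is bad by
comparison with 1. Every bad point has a bad k-th root (`exists_pow_eq_not_radiallyBounded`). If the
bad set were finite, the k-th power map would be injective on it, contradicting ζ ^ k = 1 ^ k. -/

/-! ### Digit recursion and positivity -/

/-- The second entry of the vector whose first entry is `kappa k n`. -/
def kappaSnd (k n : ℕ) : ℤ :=
  (((Nat.digits k n).map digitMatrix).prod.mulVec ![1, 0]) 1

theorem kappa_eq (k n : ℕ) :
    kappa k n = (((Nat.digits k n).map digitMatrix).prod.mulVec ![1, 0]) 0 := by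
  simp [kappa, dotProduct, Fin.sum_univ_two]

theorem kappa_zero (k : ℕ) : kappa k 0 = 1 := by simp [kappa_eq]

theorem kappaSnd_zero (k : ℕ) : kappaSnd k 0 = 0 := by simp [kappaSnd]

theorem digitMatrix_mulVec (i : ℕ) (v : Fin 2 → ℤ) :
    (digitMatrix i).mulVec v = ![((i : ℤ) + 1) * v 0 + v 1, v 0] := by
  ext j
  fin_cases j <;> simp [digitMatrix, Matrix.mulVec, dotProduct, Fin.sum_univ_two]

theorem kappa_add_mul {k : ℕ} (hk : 2 ≤ k) (n : ℕ) {i : ℕ} (hi : i < k) :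
    kappa k (i + k * n) = ((i : ℤ) + 1) * kappa k n + kappaSnd k n := by
  by_cases h : i = 0 ∧ n = 0
  · obtain ⟨rfl, rfl⟩ := h
    simp [kappa_zero, kappaSnd_zero]
  · rw [kappa_eq, Nat.digits_add k (by omega) i n hi (by omega), List.map_cons, List.prod_cons,
      ← Matrix.mulVec_mulVec, digitMatrix_mulVec]
    simp [kappa_eq, kappaSnd]

/-- The case i = n = 0 is a genuine exception: the empty digit list gives 0 for `kappaSnd` but 1 for
`kappa`. -/
theorem kappaSnd_add_mul {k : ℕ} (hk : 2 ≤ k) {n i : ℕ} (hi : i < k) (h : i ≠ 0 ∨ n ≠ 0) :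
    kappaSnd k (i + k * n) = kappa k n := by
  rw [kappaSnd, Nat.digits_add k (by omega) i n hi h, List.map_cons, List.prod_cons,
    ← Matrix.mulVec_mulVec, digitMatrix_mulVec]
  simp [kappa_eq]

theorem kappa_bounds {k : ℕ} (hk : 2 ≤ k) (n : ℕ) :
    1 ≤ kappa k n ∧ 0 ≤ kappaSnd k n ∧ kappaSnd k n ≤ kappa k n := by
  induction n using Nat.strong_induction_on with
  | _ n ih =>
    rcases Nat.eq_zero_or_pos n with rfl | hn
    · simp [kappa_zero, kappaSnd_zero]
    · obtain ⟨h1, h2, -⟩ := ih (n / k) (Nat.div_lt_self hn hk)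
      have hlt := Nat.mod_lt n (show k > 0 by omega)
      have h0 : n % k ≠ 0 ∨ n / k ≠ 0 := by
        by_contra! h
        have := Nat.mod_add_div n k
        simp [h.1, h.2] at this
        omega
      have e1 := kappa_add_mul hk (n / k) hlt
      have e2 := kappaSnd_add_mul hk hlt h0
      rw [Nat.mod_add_div] at e1 e2
      rw [e1, e2]
      have : (0 : ℤ) ≤ (n % k : ℕ) := Int.natCast_nonneg _
      refine ⟨by nlinarith, by linarith, by nlinarith⟩

/-! ### Generating functions and the functional equation -/

/-- The generating function of `kappaSnd`. -/
noncomputable def genSnd (k : ℕ) (z : ℂ) : ℂ :=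
  ∑' n : ℕ, (kappaSnd k n : ℂ) * z ^ n

theorem norm_kappaSnd_le {k : ℕ} (hk : 2 ≤ k) (n : ℕ) :
    ‖(kappaSnd k n : ℂ)‖ ≤ ‖(kappa k n : ℂ)‖ := by
  obtain ⟨h1, h2, h3⟩ := kappa_bounds hk n
  rw [Complex.norm_intCast, Complex.norm_intCast]
  have h2' : (0 : ℝ) ≤ kappaSnd k n := by exact_mod_cast h2
  have h3' : (kappaSnd k n : ℝ) ≤ kappa k n := by exact_mod_cast h3
  rw [abs_of_nonneg h2', abs_of_nonneg (h2'.trans h3')]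
  exact h3'

theorem summable_genSnd {k : ℕ} (hk : 2 ≤ k) {z : ℂ} (hz : ‖z‖ < 1) :
    Summable fun n : ℕ => (kappaSnd k n : ℂ) * z ^ n := by
  refine Summable.of_norm_bounded (summable_genK k hk z hz).norm fun n => ?_
  rw [norm_mul, norm_mul]
  gcongr
  exact norm_kappaSnd_le hk n

/-- Split the sum over n by the residue i modulo k and apply the digit recursion to each class. -/
theorem genK_functional_equation {k : ℕ} (hk : 2 ≤ k) {z : ℂ} (hz : ‖z‖ < 1) :
    genK k z = ∑ i : Fin k, z ^ (i : ℕ) * (((i : ℕ) + 1) * genK k (z ^ k) + genSnd k (z ^ k)) := by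
  have : NeZero k := ⟨by omega⟩
  have hzk : ‖z ^ k‖ < 1 := by
    rw [norm_pow]
    exact pow_lt_one₀ (norm_nonneg _) hz (by omega)
  have hs := summable_genK k hk z hz
  have h1 := (Nat.divModEquiv k).symm.hasSum_iff.2 hs.hasSum
  have h2 := (Equiv.prodComm _ _).hasSum_iff.2 h1
  have h3 : ∀ i : Fin k, HasSum (fun n : ℕ =>
      ((fun n : ℕ => (kappa k n : ℂ) * z ^ n) ∘ (Nat.divModEquiv k).symm) ((n, i) : ℕ × Fin k))
      (z ^ (i : ℕ) * (((i : ℕ) + 1) * genK k (z ^ k) + genSnd k (z ^ k))) := by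
    intro i
    have hK := (summable_genK k hk _ hzk).hasSum.mul_left (((i : ℕ) : ℂ) + 1)
    have hL := (summable_genSnd hk hzk).hasSum
    have e : (fun n : ℕ => ((fun n : ℕ => (kappa k n : ℂ) * z ^ n) ∘ (Nat.divModEquiv k).symm)
        ((n, i) : ℕ × Fin k)) = fun n : ℕ => z ^ (i : ℕ) *
          ((((i : ℕ) : ℂ) + 1) * ((kappa k n : ℂ) * (z ^ k) ^ n) +
            (kappaSnd k n : ℂ) * (z ^ k) ^ n) := by
      ext n
      have e : (Nat.divModEquiv k).symm (n, i) = i + k * n := by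
        simp [Nat.divModEquiv, add_comm, mul_comm]
      simp only [Function.comp_apply, e, kappa_add_mul hk n i.2]
      push_cast
      ring
    rw [e]
    exact (hK.add hL).mul_left (z ^ (i : ℕ))
  exact (h2.prod_fiberwise (fun i => h3 i)).unique (hasSum_fintype _)

theorem continuousOn_genK {k : ℕ} (hk : 2 ≤ k) : ContinuousOn (genK k) (Metric.ball 0 1) := by
  intro z hz
  obtain ⟨ρ, h1, h2⟩ := exists_between (mem_ball_zero_iff.1 hz)
  have hρ : 0 ≤ ρ := (norm_nonneg z).trans h1.le
  have hs := (summable_genK k hk ρ (by simpa [abs_of_nonneg hρ] using h2)).norm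
  have hc : ContinuousOn (genK k) (Metric.ball 0 ρ) := by
    refine continuousOn_tsum (fun n => by fun_prop) hs fun n w hw => ?_
    rw [norm_mul, norm_mul, norm_pow, norm_pow, Complex.norm_real, Real.norm_of_nonneg hρ]
    have := (mem_ball_zero_iff.1 hw).le
    gcongr
  exact (hc.continuousAt (Metric.isOpen_ball.mem_nhds (by simpa using h1))).continuousWithinAt

theorem norm_genSnd_le {k : ℕ} (hk : 2 ≤ k) {x : ℝ} (hx0 : 0 ≤ x) (hx1 : x < 1) :
    ‖genSnd k x‖ ≤ ‖genK k x‖ := by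
  have hx : ‖(x : ℂ)‖ < 1 := by simpa [abs_of_nonneg hx0] using hx1
  have hK := (Complex.hasSum_re (summable_genK k hk x hx).hasSum)
  have hL := (summable_genSnd hk hx).norm
  refine (norm_tsum_le_tsum_norm hL).trans (le_trans ?_ (Complex.re_le_norm _))
  refine le_trans (Summable.tsum_le_tsum (fun n => ?_) hL hK.summable) hK.tsum_eq.le
  have h1 : (0 : ℝ) ≤ kappa k n := by exact_mod_cast zero_le_one.trans (kappa_bounds hk n).1
  have e : (((kappa k n : ℂ) * (x : ℂ) ^ n)).re = kappa k n * x ^ n := by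
    rw [show (kappa k n : ℂ) * (x : ℂ) ^ n = ((kappa k n * x ^ n : ℝ) : ℂ) by push_cast; rfl,
      Complex.ofReal_re]
  have h2 := norm_kappaSnd_le hk n
  rw [Complex.norm_intCast (kappa k n), abs_of_nonneg h1] at h2
  rw [e, norm_mul, norm_pow, Complex.norm_real, Real.norm_of_nonneg hx0]
  gcongr

theorem inv_one_sub_le_norm_genK {k : ℕ} (hk : 2 ≤ k) {x : ℝ} (hx0 : 0 ≤ x) (hx1 : x < 1) :
    (1 - x)⁻¹ ≤ ‖genK k x‖ := by
  have hx : ‖(x : ℂ)‖ < 1 := by simpa [abs_of_nonneg hx0] using hx1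
  have hK := (Complex.hasSum_re (summable_genK k hk x hx).hasSum)
  refine le_trans ?_ (Complex.re_le_norm _)
  refine hasSum_le (fun n => ?_) (hasSum_geometric_of_lt_one hx0 hx1) hK
  have h1 : (1 : ℝ) ≤ kappa k n := by exact_mod_cast (kappa_bounds hk n).1
  rw [show (kappa k n : ℂ) * (x : ℂ) ^ n = ((kappa k n * x ^ n : ℝ) : ℂ) by push_cast; rfl,
      Complex.ofReal_re]
  exact le_mul_of_one_le_left (by positivity) h1

/-! ### Radial growth on the unit circle -/

/-- Boundedness of `genK k` along the radius that ends at `ξ`. -/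
def RadiallyBounded (k : ℕ) (ξ : ℂ) : Prop :=
  (fun r : ℝ => genK k (r * ξ)) =O[𝓝[<] (1 : ℝ)] fun _ => (1 : ℝ)

theorem tendsto_rpow_nhdsLT_one {a : ℝ} (ha : 0 < a) :
    Tendsto (fun r : ℝ => r ^ a) (𝓝[<] 1) (𝓝[<] 1) := by
  refine tendsto_nhdsWithin_iff.2 ⟨?_, ?_⟩
  · have h : ContinuousAt (fun r : ℝ => r ^ a) 1 :=
      Real.continuousAt_rpow_const _ _ (Or.inl one_ne_zero)
    simpa using h.tendsto.mono_left nhdsWithin_le_nhds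
  · filter_upwards [Ioo_mem_nhdsLT (zero_lt_one' ℝ)] with r hr
    exact Real.rpow_lt_one hr.1.le hr.2 ha

/-- Substitute r ^ (1/k) for r, which preserves left neighbourhoods of 1. -/
theorem isBigO_one_of_comp_pow {f : ℝ → ℂ} {k : ℕ} (hk : k ≠ 0)
    (h : (fun r : ℝ => f (r ^ k)) =O[𝓝[<] (1 : ℝ)] fun _ => (1 : ℝ)) :
    f =O[𝓝[<] (1 : ℝ)] fun _ => (1 : ℝ) := by
  have hk' : (0 : ℝ) < k := by exact_mod_cast Nat.pos_of_ne_zero hk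
  refine (h.comp_tendsto (tendsto_rpow_nhdsLT_one (inv_pos.2 hk'))).congr' ?_ .rfl
  filter_upwards [Ioo_mem_nhdsLT (zero_lt_one' ℝ)] with r hr
  simp only [Function.comp_apply]
  rw [Real.rpow_inv_natCast_pow hr.1.le hk]

theorem not_radiallyBounded_one {k : ℕ} (hk : 2 ≤ k) : ¬ RadiallyBounded k 1 := by
  intro h
  obtain ⟨C, hC⟩ := h.bound
  have ht : Tendsto (fun x : ℝ => (1 - x)⁻¹) (𝓝[<] 1) atTop := by
    refine tendsto_inv_nhdsGT_zero.comp (tendsto_nhdsWithin_iff.2 ⟨?_, ?_⟩)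
    · have h : ContinuousAt (fun r : ℝ => 1 - r) 1 := by fun_prop
      simpa using h.tendsto.mono_left nhdsWithin_le_nhds
    · filter_upwards [self_mem_nhdsWithin] with r hr
      simpa using hr
  obtain ⟨r, h1, h2, h3⟩ := (hC.and ((ht.eventually_gt_atTop C).and
    (Ioo_mem_nhdsLT (zero_lt_one' ℝ)))).exists
  have := inv_one_sub_le_norm_genK hk h3.1.le h3.2
  simp only [mul_one, norm_one] at h1
  linarith

theorem norm_ofReal_mul_lt_one {ξ : ℂ} (hξ : ‖ξ‖ = 1) {r : ℝ} (hr : r ∈ Set.Ioo (0 : ℝ) 1) :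
    ‖(r : ℂ) * ξ‖ < 1 := by
  rw [norm_mul, hξ, mul_one, Complex.norm_real, Real.norm_of_nonneg hr.1.le]
  exact hr.2

/-- Multiplication by ζ - 1 telescopes the sum to k. -/
theorem IsPrimitiveRoot.sum_add_one_mul_pow_ne_zero {k : ℕ} (hk : 2 ≤ k) {ζ : ℂ}
    (hζ : IsPrimitiveRoot ζ k) : ∑ i : Fin k, ζ ^ (i : ℕ) * ((i : ℕ) + 1) ≠ 0 := by
  have key : ∀ n : ℕ, (∑ i ∈ Finset.range n, ζ ^ i * ((i : ℂ) + 1)) * (ζ - 1) =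
      n * ζ ^ n - ∑ i ∈ Finset.range n, ζ ^ i := by
    intro n
    induction n with
    | zero => simp
    | succ n ih =>
      rw [Finset.sum_range_succ, Finset.sum_range_succ, add_mul, ih]
      push_cast
      ring
  have h := key k
  rw [hζ.geom_sum_eq_zero (by omega), hζ.pow_eq_one, ← Fin.sum_univ_eq_sum_range
    (fun i => ζ ^ i * ((i : ℂ) + 1))] at h
  intro h0
  rw [h0] at h
  have : (k : ℂ) ≠ 0 := by exact_mod_cast (show k ≠ 0 by omega)
  simp_all

/-- On the radius to ζ the functional equation reads K(rζ) = Q(r) K(r^k) + P(r) L(r^k) with P(1) = 0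
and Q(1) ≠ 0. Since |L| ≤ |K| on [0, 1), the second term is absorbed, and a bound for K(rζ) would
bound K(r^k). -/
theorem IsPrimitiveRoot.not_radiallyBounded {k : ℕ} (hk : 2 ≤ k) {ζ : ℂ}
    (hζ : IsPrimitiveRoot ζ k) : ¬ RadiallyBounded k ζ := by
  intro h
  refine not_radiallyBounded_one hk ?_
  have hk0 : k ≠ 0 := by omega
  have hnorm : ‖ζ‖ = 1 := hζ.norm'_eq_one hk0
  set Q : ℝ → ℂ := fun r => ∑ i : Fin k, (r * ζ) ^ (i : ℕ) * ((i : ℕ) + 1) with hQ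
  set P : ℝ → ℂ := fun r => ∑ i : Fin k, (r * ζ) ^ (i : ℕ) with hP
  have hQ1 : Q 1 ≠ 0 := by simpa [hQ] using hζ.sum_add_one_mul_pow_ne_zero hk
  have hP1 : P 1 = 0 := by
    simp only [hP, Complex.ofReal_one, one_mul]
    rw [Fin.sum_univ_eq_sum_range (fun i => ζ ^ i)]
    exact hζ.geom_sum_eq_zero (by omega)
  have hc : ContinuousAt (fun r => ‖Q r‖ - ‖P r‖) 1 := by
    simp only [hQ, hP]
    fun_prop
  have hpos : 0 < ‖Q 1‖ := norm_pos_iff.2 hQ1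
  have hev : ∀ᶠ r in 𝓝[<] (1 : ℝ), ‖Q 1‖ / 2 < ‖Q r‖ - ‖P r‖ := by
    refine nhdsWithin_le_nhds (hc.eventually_const_lt ?_)
    simp only [hP1, norm_zero]
    linarith
  refine isBigO_one_of_comp_pow (f := fun r : ℝ => genK k (r * 1)) hk0 (.trans ?_ h)
  refine Asymptotics.IsBigO.of_bound (‖Q 1‖ / 2)⁻¹ ?_
  filter_upwards [hev, Ioo_mem_nhdsLT (zero_lt_one' ℝ)] with r hr1 hr
  have hfe := genK_functional_equation hk (norm_ofReal_mul_lt_one hnorm hr)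
  have hL := norm_genSnd_le hk (pow_nonneg hr.1.le k) (pow_lt_one₀ hr.1.le hr.2 hk0)
  have e : genK k (r * ζ) = Q r * genK k ((r ^ k : ℝ) : ℂ) + P r * genSnd k ((r ^ k : ℝ) : ℂ) := by
    rw [hfe, mul_pow, hζ.pow_eq_one, mul_one]
    simp only [hQ, hP, Finset.sum_mul, ← Finset.sum_add_distrib]
    refine Finset.sum_congr rfl fun i _ => ?_
    push_cast
    ring
  rw [mul_one, inv_mul_eq_div, le_div_iff₀ (by positivity)]
  have h1 := norm_sub_le_norm_add (Q r * genK k ((r ^ k : ℝ) : ℂ)) (P r * genSnd k ((r ^ k : ℝ) : ℂ))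
  rw [← e, norm_mul, norm_mul] at h1
  have h2 := mul_le_mul_of_nonneg_left hL (norm_nonneg (P r))
  nlinarith [norm_nonneg (genK k ((r ^ k : ℝ) : ℂ))]

/-- At the k distinct k-th roots of ξ, the functional equations form a Vandermonde system whose
unknowns involve only K and L at r^k ξ. Were K radially bounded at every root, inverting the system
would bound all the unknowns, and K(r^k ξ) is a combination of two of them. -/
theorem exists_pow_eq_not_radiallyBounded {k : ℕ} (hk : 2 ≤ k) {ξ : ℂ} (hξ : ‖ξ‖ = 1)
    (h : ¬ RadiallyBounded k ξ) : ∃ ω : ℂ, ω ^ k = ξ ∧ ¬ RadiallyBounded k ω := by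
  have hk0 : k ≠ 0 := by omega
  by_contra! hall
  refine h (isBigO_one_of_comp_pow (f := fun r : ℝ => genK k (r * ξ)) hk0 ?_)
  obtain ⟨ω₀, hω₀⟩ := IsAlgClosed.exists_pow_nat_eq ξ (Nat.pos_of_ne_zero hk0)
  have hζ := Complex.isPrimitiveRoot_exp k hk0
  set ζ := Complex.exp (2 * Real.pi * Complex.I / k)
  have hω0 : ω₀ ≠ 0 := by
    rintro rfl
    rw [zero_pow hk0] at hω₀
    simp [← hω₀] at hξ
  set ω : Fin k → ℂ := fun j => ω₀ * ζ ^ (j : ℕ) with hω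
  have hinj : Function.Injective ω := fun i j hij =>
    Fin.ext (hζ.pow_inj i.2 j.2 (mul_left_cancel₀ hω0 hij))
  have hpow : ∀ j, ω j ^ k = ξ := fun j => by
    simp only [hω]
    rw [mul_pow, hω₀, pow_right_comm, hζ.pow_eq_one, one_pow, mul_one]
  have hnorm : ∀ j, ‖ω j‖ = 1 := fun j => by
    rw [← pow_eq_one_iff_of_nonneg (norm_nonneg _) hk0, ← norm_pow, hpow, hξ]
  set V := Matrix.vandermonde ω with hV
  have hdet : IsUnit V.det := (Matrix.det_vandermonde_ne_zero_iff.2 hinj).isUnit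
  set c : ℝ → Fin k → ℂ := fun r i =>
    (r : ℂ) ^ (i : ℕ) * (((i : ℕ) + 1) * genK k (r ^ k * ξ) + genSnd k (r ^ k * ξ)) with hc
  have hVc : ∀ r ∈ Set.Ioo (0 : ℝ) 1, V.mulVec (c r) = fun j => genK k (r * ω j) := by
    intro r hr
    ext j
    rw [genK_functional_equation hk (norm_ofReal_mul_lt_one (hnorm j) hr), mul_pow, hpow]
    simp only [Matrix.mulVec, dotProduct, hV, Matrix.vandermonde_apply, hc]
    refine Finset.sum_congr rfl fun i _ => ?_
    ring
  have hcO : ∀ i, (fun r => c r i) =O[𝓝[<] (1 : ℝ)] fun _ => (1 : ℝ) := by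
    intro i
    have hsum : (fun r : ℝ => ∑ j, V⁻¹ i j * genK k (r * ω j)) =O[𝓝[<] (1 : ℝ)]
        fun _ => (1 : ℝ) :=
      Asymptotics.IsBigO.fun_sum fun j _ => (hall (ω j) (hpow j)).const_mul_left _
    refine hsum.congr' ?_ .rfl
    filter_upwards [Ioo_mem_nhdsLT (zero_lt_one' ℝ)] with r hr
    have : c r = V⁻¹.mulVec (fun j => genK k (r * ω j)) := by
      rw [← hVc r hr, Matrix.mulVec_mulVec, Matrix.nonsing_inv_mul _ hdet, Matrix.one_mulVec]
    rw [this]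
    rfl
  have hinv : (fun r : ℝ => (r : ℂ)⁻¹) =O[𝓝[<] (1 : ℝ)] fun _ => (1 : ℝ) := by
    have : ContinuousAt (fun r : ℝ => (r : ℂ)⁻¹) 1 :=
      Complex.continuous_ofReal.continuousAt.inv₀ (by simp)
    exact (this.tendsto.mono_left nhdsWithin_le_nhds).isBigO_one ℝ
  -- Here c₀ = K + L and c₁ / r = 2K + L, so their difference is K(r^k ξ).
  have h0 := hcO ⟨0, by omega⟩
  have h1 := hinv.mul (hcO ⟨1, by omega⟩)
  simp only [mul_one] at h1
  refine (h1.sub h0).congr' ?_ .rfl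
  filter_upwards [Ioo_mem_nhdsLT (zero_lt_one' ℝ)] with r hr
  have : (r : ℂ) ≠ 0 := by exact_mod_cast hr.1.ne'
  simp only [hc]
  push_cast
  field_simp
  ring

/-- A finite set contained in its image under the k-th power map is mapped injectively, yet 1 and ζ
have the same image. -/
theorem infinite_not_radiallyBounded {k : ℕ} (hk : 2 ≤ k) :
    {ξ : ℂ | ‖ξ‖ = 1 ∧ ¬ RadiallyBounded k ξ}.Infinite := by
  have hk0 : k ≠ 0 := by omega
  intro hfin
  set T := hfin.toFinset with hT
  have hmem : ∀ ξ, ξ ∈ T ↔ ‖ξ‖ = 1 ∧ ¬ RadiallyBounded k ξ := fun ξ => by simp [hT]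
  have hsub : T ⊆ T.image (· ^ k) := by
    intro ξ hξ
    obtain ⟨h1, h2⟩ := (hmem ξ).1 hξ
    obtain ⟨ω, hω, h3⟩ := exists_pow_eq_not_radiallyBounded hk h1 h2
    refine Finset.mem_image.2 ⟨ω, (hmem ω).2 ⟨?_, h3⟩, hω⟩
    rw [← pow_eq_one_iff_of_nonneg (norm_nonneg _) hk0, ← norm_pow, hω, h1]
  have hinj := Finset.card_image_iff.1
    (le_antisymm Finset.card_image_le (Finset.card_le_card hsub))
  have hζ := Complex.isPrimitiveRoot_exp k hk0
  refine hζ.ne_one (by omega) (hinj ((hmem _).2 ⟨hζ.norm'_eq_one hk0, hζ.not_radiallyBounded hk⟩)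
    ((hmem 1).2 ⟨norm_one, not_radiallyBounded_one hk⟩) ?_)
  simp [hζ.pow_eq_one]

/-! ### Boundedness forced by an algebraic relation -/

/-- Cauchy's root bound: for |x| > 1 the lower terms total at most d C |x|^(d-1), against at least c
|x|^d for the top term. -/
theorem norm_le_of_sum_mul_pow_eq_zero {d : ℕ} {a : ℕ → ℂ} {x : ℂ} {c C : ℝ} (hc : 0 < c)
    (hd : c ≤ ‖a d‖) (hC : ∀ i < d, ‖a i‖ ≤ C)
    (h : ∑ i ∈ Finset.range (d + 1), a i * x ^ i = 0) : ‖x‖ ≤ max 1 (d * C / c) := by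
  by_contra! hx
  obtain ⟨h1, h2⟩ := max_lt_iff.1 hx
  rw [Finset.sum_range_succ, add_comm, add_eq_zero_iff_eq_neg] at h
  have h3 : c * ‖x‖ ^ d ≤ d * C * ‖x‖ ^ (d - 1) := by
    calc c * ‖x‖ ^ d ≤ ‖a d * x ^ d‖ := by rw [norm_mul, norm_pow]; gcongr
      _ = ‖∑ i ∈ Finset.range d, a i * x ^ i‖ := by rw [h, norm_neg]
      _ ≤ ∑ i ∈ Finset.range d, C * ‖x‖ ^ (d - 1) := by
        refine norm_sum_le_of_le _ fun i hi => ?_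
        have hi := Finset.mem_range.1 hi
        rw [norm_mul, norm_pow]
        have h0 := hC i hi
        have h0' := (norm_nonneg _).trans h0
        have := pow_le_pow_right₀ h1.le (show i ≤ d - 1 by omega)
        gcongr
      _ = d * C * ‖x‖ ^ (d - 1) := by simp [mul_assoc]
  have hxp : 0 < ‖x‖ ^ (d - 1) := by positivity
  -- For d = 0 the exponent d - 1 is truncated, but the inequality then reads c ≤ 0, which is
  -- absurd.
  rcases Nat.eq_zero_or_pos d with rfl | hd0
  · simp at h3
    linarith
  · obtain ⟨e, rfl⟩ := Nat.exists_eq_succ_of_ne_zero hd0.ne'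
    rw [Nat.succ_eq_add_one, Nat.add_sub_cancel] at h3 hxp
    rw [pow_succ', ← mul_assoc] at h3
    have h4 := le_of_mul_le_mul_right h3 hxp
    rw [div_lt_iff₀ hc] at h2
    linarith

theorem Meromorphic.finite_sphere_not_analyticAt {f : ℂ → ℂ} (hf : Meromorphic f) :
    (Metric.sphere (0 : ℂ) 1 \ {z | AnalyticAt ℂ f z}).Finite :=
  (isCompact_sphere 0 1).finite_sdiff_of_mem_codiscreteWithin
    (hf.meromorphicOn.analyticAt_mem_codiscreteWithin)

/-- By the identity theorem on ℂ, f has finite order everywhere unless it vanishes near every point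
(the point itself excepted), which would make its germ zero. Finite order keeps zeros from
accumulating on the compact circle. -/
theorem Meromorphic.finite_sphere_eq_zero {f : ℂ → ℂ} (hf : Meromorphic f)
    (h : DiscFunction.of f ≠ 0) : (Metric.sphere (0 : ℂ) 1 \ {z | f z ≠ 0}).Finite := by
  have h1 : ∃ u, meromorphicOrderAt f u ≠ ⊤ := by
    by_contra! htop
    refine h (Germ.coe_eq.2 ?_)
    rw [EventuallyEq, eventually_iff, mem_codiscreteWithin]
    intro x _
    rw [disjoint_principal_right]
    filter_upwards [meromorphicOrderAt_eq_top_iff.1 (htop x)] with z hz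
    simp [hz]
  rw [hf.exists_meromorphicOrderAt_ne_top_iff_forall] at h1
  exact (isCompact_sphere 0 1).finite_sdiff_of_mem_codiscreteWithin
    (hf.meromorphicOn.eventually_codiscreteWithin_apply_ne_zero fun x _ => h1 x)

/-- A function that is continuous on the disc and bounded near a boundary point, off a set that is
discrete in the disc, is radially bounded at that point. -/
theorem RadiallyBounded.of_eventually {k : ℕ} (hk : 2 ≤ k) {ξ : ℂ} (hξ : ‖ξ‖ = 1) {S : Set ℂ}
    (hS : S ∈ codiscreteWithin (Metric.ball (0 : ℂ) 1)) {B : ℝ}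
    (h : ∀ᶠ z in 𝓝 ξ, z ∈ S → ‖genK k z‖ ≤ B) : RadiallyBounded k ξ := by
  have hray : Tendsto (fun r : ℝ => (r : ℂ) * ξ) (𝓝[<] 1) (𝓝 ξ) := by
    have : ContinuousAt (fun r : ℝ => (r : ℂ) * ξ) 1 := by fun_prop
    simpa using this.tendsto.mono_left nhdsWithin_le_nhds
  refine Asymptotics.IsBigO.of_bound B ?_
  filter_upwards [hray.eventually h.eventually_nhds, Ioo_mem_nhdsLT (zero_lt_one' ℝ)] with r hr1 hr2
  have hmem : (r : ℂ) * ξ ∈ Metric.ball (0 : ℂ) 1 :=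
    mem_ball_zero_iff.2 (norm_ofReal_mul_lt_one hξ hr2)
  have hcont := (continuousOn_genK hk).continuousAt (Metric.isOpen_ball.mem_nhds hmem)
  rw [norm_one, mul_one]
  -- The bound holds on a punctured neighbourhood of each point of the radius close to ξ; continuity
  -- of K carries it to the point itself, even if that point lies outside S.
  refine le_of_tendsto (hcont.norm.tendsto.mono_left (nhdsWithin_le_nhds (s := {(r : ℂ) * ξ}ᶜ))) ?_
  have h1 := mem_codiscreteWithin_iff_forall_mem_nhdsNE.1 hS _ hmem
  filter_upwards [h1, nhdsWithin_le_nhds hr1,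
    nhdsWithin_le_nhds (Metric.isOpen_ball.mem_nhds hmem)] with z hz1 hz2 hz3
  exact hz2 (hz1.resolve_right (not_not_intro hz3))

theorem not_isRoot_of_coeff_meromorphic {k : ℕ} (hk : 2 ≤ k) {p : Polynomial DiscFunction}
    (hp : p ≠ 0) (hcoeff : ∀ i, ∃ f, Meromorphic f ∧ DiscFunction.of f = p.coeff i) :
    p.eval (DiscFunction.of (genK k)) ≠ 0 := by
  intro h
  choose f hf hfp using hcoeff
  set d := p.natDegree with hd
  have hlead : DiscFunction.of (f d) ≠ 0 := by
    rw [hfp, hd]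
    exact Polynomial.leadingCoeff_ne_zero.2 hp
  have hrel : ∀ᶠ z in codiscreteWithin (Metric.ball (0 : ℂ) 1),
      ∑ i ∈ Finset.range (d + 1), f i z * genK k z ^ i = 0 := by
    rw [Polynomial.eval_eq_sum_range] at h
    simp only [← hfp] at h
    have e : ((fun z => ∑ i ∈ Finset.range (d + 1), f i z * genK k z ^ i : ℂ → ℂ) :
        DiscFunction) = ∑ i ∈ Finset.range (d + 1),
          DiscFunction.of (f i) * DiscFunction.of (genK k) ^ i := by
      generalize d + 1 = n
      induction n with
      | zero => rfl
      | succ n ih =>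
        rw [Finset.sum_range_succ, ← ih]
        simp only [Finset.sum_range_succ]
        rfl
    exact Germ.coe_eq.1 (e.trans h)
  -- E collects the points of the circle where some coefficient fails to be analytic or the leading
  -- one vanishes.
  set E : Set ℂ := (⋃ i ∈ Finset.range (d + 1), Metric.sphere (0 : ℂ) 1 \ {z | AnalyticAt ℂ (f i) z})
    ∪ (Metric.sphere (0 : ℂ) 1 \ {z | f d z ≠ 0}) with hE
  have hEfin : E.Finite :=
    (Set.Finite.biUnion (Finset.finite_toSet _) fun i _ => (hf i).finite_sphere_not_analyticAt).union
      ((hf d).finite_sphere_eq_zero hlead)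
  obtain ⟨ξ, ⟨hξ, hunb⟩, hξE⟩ := ((infinite_not_radiallyBounded hk).sdiff hEfin).nonempty
  have hξs : ξ ∈ Metric.sphere (0 : ℂ) 1 := by simpa using hξ
  have han : ∀ i < d + 1, AnalyticAt ℂ (f i) ξ := by
    intro i hi
    by_contra hna
    exact hξE (Or.inl (Set.mem_biUnion (Finset.mem_coe.2 (Finset.mem_range.2 hi)) ⟨hξs, hna⟩))
  have hne : f d ξ ≠ 0 := by
    by_contra h0
    exact hξE (Or.inr ⟨hξs, not_not_intro h0⟩)
  have hpos := norm_pos_iff.2 hne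
  -- The added 1 makes the bounds strict at ξ, so that they persist nearby.
  set C : ℝ := ∑ i ∈ Finset.range d, ‖f i ξ‖ + 1 with hC
  have hev1 : ∀ᶠ z in 𝓝 ξ, ‖f d ξ‖ / 2 < ‖f d z‖ :=
    (han d (by omega)).continuousAt.norm.eventually_const_lt (by linarith)
  have hev2 : ∀ᶠ z in 𝓝 ξ, ∀ i ∈ Finset.range d, ‖f i z‖ < C := by
    rw [Finset.eventually_all]
    intro i hi
    have := Finset.mem_range.1 hi
    refine (han i (by omega)).continuousAt.norm.eventually_lt_const ?_
    have := Finset.single_le_sum (f := fun i => ‖f i ξ‖) (fun _ _ => norm_nonneg _) hi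
    linarith
  refine hunb (.of_eventually hk hξ hrel (B := max 1 (d * C / (‖f d ξ‖ / 2))) ?_)
  filter_upwards [hev1, hev2] with z hz1 hz2 hz
  exact norm_le_of_sum_mul_pow_eq_zero (a := fun i => f i z) (by linarith) hz1.le
    (fun i hi => (hz2 i (Finset.mem_range.2 hi)).le) hz

/-! ### Transcendence and algebraic independence -/

/-- The base ring is left general so that the result serves both for ℂ(z) and for ℂ(z)[G]. -/
theorem transcendental_genK {k : ℕ} (hk : 2 ≤ k) {R : Type*} [CommRing R] [Algebra R DiscFunction]
    (hinj : Function.Injective (algebraMap R DiscFunction))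
    (hmer : ∀ r : R, ∃ f, Meromorphic f ∧ DiscFunction.of f = algebraMap R DiscFunction r) :
    Transcendental R (DiscFunction.of (genK k)) := by
  rintro ⟨p, hp, h⟩
  refine not_isRoot_of_coeff_meromorphic hk (p := p.map (algebraMap R DiscFunction))
    ((Polynomial.map_ne_zero_iff hinj).2 hp) (fun i => ?_) (by rwa [Polynomial.eval_map_algebraMap])
  rw [Polynomial.coeff_map]
  exact hmer _

theorem meromorphic_ratFunc_eval (r : RatFunc ℂ) :
    Meromorphic fun z => r.eval (RingHom.id ℂ) z := by
  intro z
  have h : ∀ p : Polynomial ℂ, MeromorphicAt (fun z => p.eval₂ (RingHom.id ℂ) z) z := fun p => by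
    simp only [Polynomial.eval₂_id]
    exact (p.differentiable.analyticAt z).meromorphicAt
  exact (h r.num).div (h r.denom)

/-- The germs in the disc of the functions that are meromorphic on `ℂ`. -/
noncomputable def meromorphicGerms : Subalgebra (RatFunc ℂ) DiscFunction where
  carrier := {x | ∃ f, Meromorphic f ∧ DiscFunction.of f = x}
  mul_mem' := by
    rintro _ _ ⟨f, hf, rfl⟩ ⟨g, hg, rfl⟩
    exact ⟨f * g, hf.mul hg, rfl⟩
  add_mem' := by
    rintro _ _ ⟨f, hf, rfl⟩ ⟨g, hg, rfl⟩
    exact ⟨f + g, hf.add hg, rfl⟩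
  algebraMap_mem' r := ⟨_, meromorphic_ratFunc_eval r, rfl⟩

/-- Needed for the map from the field ℂ(z) to be injective; the filter is proper because punctured
neighbourhoods of 0 are nonempty. -/
instance : Nontrivial DiscFunction := by
  have : NeBot (codiscreteWithin (Metric.ball (0 : ℂ) 1)) := by
    have h0 : (0 : ℂ) ∈ Metric.ball (0 : ℂ) 1 := by simp
    refine ⟨fun hbot => ?_⟩
    have h := mem_codiscreteWithin_iff_forall_mem_nhdsNE.1
      (show (∅ : Set ℂ) ∈ codiscreteWithin (Metric.ball (0 : ℂ) 1) by rw [hbot]; trivial) 0 h0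
    obtain ⟨z, hz1, hz2⟩ := (nhdsWithin (0 : ℂ) {0}ᶜ).nonempty_of_mem
      (inter_mem h (nhdsWithin_le_nhds (Metric.isOpen_ball.mem_nhds h0)))
    simp_all
  infer_instance

theorem mainTheorem5 (k : ℕ) (hk : 2 ≤ k) :
    (∀ G : ℂ → ℂ, Meromorphic G → Transcendental (RatFunc ℂ) (DiscFunction.of G) →
      AlgebraicIndependent (RatFunc ℂ) ![DiscFunction.of (genK k), DiscFunction.of G]) ∧
    Transcendental (RatFunc ℂ) (DiscFunction.of (genK k)) := by
  refine ⟨fun G hG hGt => ?_, transcendental_genK hk (algebraMap (RatFunc ℂ) DiscFunction).injective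
    fun r => meromorphicGerms.algebraMap_mem r⟩
  have hx : AlgebraicIndependent (RatFunc ℂ) (fun _ : Fin 1 => DiscFunction.of G) :=
    algebraicIndependent_unique_type_iff.2 hGt
  have hle : Algebra.adjoin (RatFunc ℂ) (Set.range fun _ : Fin 1 => DiscFunction.of G) ≤
      meromorphicGerms := by
    refine Algebra.adjoin_le ?_
    rintro _ ⟨_, rfl⟩
    exact ⟨G, hG, rfl⟩
  have hK := (hx.option_iff_transcendental (DiscFunction.of (genK k))).2
    (transcendental_genK hk Subtype.val_injective fun r => hle r.2)
  -- Adjoining K to the family (G) indexes the pair by `Option (Fin 1)`; `finSuccEquiv 1` reindexes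
  -- it by `Fin 2`, with K at 0.
  convert hK.comp _ (finSuccEquiv 1).injective using 1
  ext i
  fin_cases i <;> rfl
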